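/- Let $H:\mathbb R\to\mathbb R$ be the function $$H(p)=\begin{cases}\frac54p^3+\frac{19}8p^2+\frac{15}{16}p+\frac5{32} & p\le -\frac12,\\ \frac12p^2 & -\frac12\le p\le\frac12,\\ -\frac54p^3+\frac{19}8p^2-\frac{15}{16}p+\frac5{32} & p\ge\frac12.\end{cases}$$ Then $H$ is $C^2$, even and not convex, and the following hold. (1) There are a Lipschitz function $v_0:\mathbb R\to\mathbb R$ and a bounded weak (distributional) solution $v$ on $[0,\infty)\times\mathbb R$ of $$\partial_t v+\partial_x(H(v))=0,\qquad v(0,\cdot)=v_0,$$ which is one-sided Lipschitz in space uniformly in time (there is $c\ge 0$ such that $v(t,x)-v(t,y)\ge -c(x-y)$ for all $t\ge0$ and all $x\ge y$), but which is not an entropy solution, that is, the inequality $\partial_tE(v)+\partial_xF(v)\le0$ (in the sense of distributions, with initial datum $v_0$) fails for some convex differentiable $E$ and some $F$ with $F'=H'E'$. (2) Moreover $v_0,v$ in (1) can be chosen so that there is a Lipschitz function $f:[0,\infty)\times\mathbb R\to\mathbb R$ such that $f(t,\cdot)$ is a primitive of $-v(t,\cdot)$ for every $t\ge 0$; $f(0,\cdot)$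 is $C^{1,1}$ (differentiable with Lipschitz derivative); $\partial_tf-H(\partial_xf)=0$ almost everywhere; and, for some $c>0$, the function $x\mapsto c x^2-f(t,x)$ is convex for every $t\ge0$; but $f$ is not a viscosity solution of $\partial_tu-H(\partial_xu)=0$, $u(0,\cdot)=f(0,\cdot)$, on $[0,\infty)\times\mathbb R$. (3) Consequently the following selection principle, known for strictly convex $C^2$ nonlinearities, fails for this $H$: "for every $T\ge0$ and every Lipschitz $f:[0,T]\times\mathbb R\to\mathbb R$ with $f(0,\cdot)\in C^{1,1}$ and $\partial_tf-H(\partial_xf)=0$ almost everywhere, for which there is $c>0$ such that $x\mapsto cx^2-f(t,x)$ is convex for all $t\in[0,T]$, the function $f$ is the viscosity solution of $\partial_tu-H(\partial_xu)=0$, $u(0,\cdot)=f(0,\cdot)$ on $[0,T]\times\mathbb R$." -/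

import Mathlib

open MeasureTheory Set
open scoped ContDiff

namespace HJCounterexample

/-- The explicit nonlinearity: quadratic on `[-1/2, 1/2]`, cubic outside. -/
noncomputable def nonlinearity (p : ℝ) : ℝ :=
  if p ≤ -(1 / 2) then 5 / 4 * p ^ 3 + 19 / 8 * p ^ 2 + 15 / 16 * p + 5 / 32
  else if p ≤ 1 / 2 then 1 / 2 * p ^ 2
  else -(5 / 4) * p ^ 3 + 19 / 8 * p ^ 2 - 15 / 16 * p + 5 / 32

/-! ### The conservation law `∂ₜ v + ∂ₓ (H v) = 0`, `v(0, ·) = v₀`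

Functions of time and space are written `v t x`; only the values at `t ≥ 0` matter. A point of
`ℝ × ℝ` is `(t, x)`, so `fderiv ℝ φ z (1, 0)` is `∂ₜ φ` and `fderiv ℝ φ z (0, 1)` is `∂ₓ φ`. -/

/-- `φ x - φ y ≥ -c (x - y)` for all `x ≥ y`. -/
def OneSidedLipschitzWith (c : ℝ) (φ : ℝ → ℝ) : Prop :=
  ∀ x y : ℝ, y ≤ x → -c * (x - y) ≤ φ x - φ y

/-- The pairing `∫_{t > 0} ∫ₓ (A(v) ∂ₜ φ + B(v) ∂ₓ φ) + ∫ₓ A(v₀) φ(0, ·)`. -/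
noncomputable def weakPairing (A B : ℝ → ℝ) (v₀ : ℝ → ℝ) (v : ℝ → ℝ → ℝ) (φ : ℝ × ℝ → ℝ) : ℝ :=
  (∫ z in Ioi (0 : ℝ) ×ˢ (univ : Set ℝ),
      (A (v z.1 z.2) * fderiv ℝ φ z (1, 0) + B (v z.1 z.2) * fderiv ℝ φ z (0, 1)))
    + ∫ x, A (v₀ x) * φ (0, x)

/-- Bounded weak (distributional) solution of `∂ₜ v + ∂ₓ (H v) = 0`, `v(0, ·) = v₀`. -/
structure IsWeakSolution (H v₀ : ℝ → ℝ) (v : ℝ → ℝ → ℝ) : Prop where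
  measurable : Measurable (Function.uncurry v)
  bounded : ∃ M : ℝ, ∀ t, 0 ≤ t → ∀ x, |v t x| ≤ M
  weak : ∀ φ : ℝ × ℝ → ℝ, ContDiff ℝ ∞ φ → HasCompactSupport φ →
    weakPairing (fun p => p) H v₀ v φ = 0

/-- Entropy solution: for every entropy-entropy flux pair `(E, F)`, that is `E` convex and
`F' = H' E'`, one has `∂ₜ E(v) + ∂ₓ F(v) ≤ 0` in the distributional sense, with initial
datum `v₀`. -/
structure IsEntropySolution (H v₀ : ℝ → ℝ) (v : ℝ → ℝ → ℝ) : Prop where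
  isWeakSolution : IsWeakSolution H v₀ v
  entropy : ∀ E E' F : ℝ → ℝ, ConvexOn ℝ univ E → (∀ p, HasDerivAt E (E' p) p) →
    (∀ p, HasDerivAt F (deriv H p * E' p) p) →
    ∀ φ : ℝ × ℝ → ℝ, ContDiff ℝ ∞ φ → HasCompactSupport φ → (∀ z, 0 ≤ φ z) →
      0 ≤ weakPairing E F v₀ v φ

/-! ### The Hamilton-Jacobi equation `∂ₜ u - H(∂ₓ u) = 0` on `I × ℝ`

The time set `I` is `[0, T]` or `[0, ∞)`. -/

/-- `g` is differentiable with Lipschitz derivative. -/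
def IsC11 (g : ℝ → ℝ) : Prop :=
  Differentiable ℝ g ∧ ∃ K, LipschitzWith K (deriv g)

/-- `f` is Lipschitz on `I × ℝ`, has a `C^{1,1}` initial datum, solves `∂ₜ f - H(∂ₓ f) = 0` almost
everywhere on `I × ℝ`, and is semi-concave in space, uniformly in time. -/
structure IsSemiconcaveSolution (H : ℝ → ℝ) (I : Set ℝ) (f : ℝ → ℝ → ℝ) : Prop where
  lipschitz : ∃ K, LipschitzOnWith K (Function.uncurry f) (I ×ˢ (univ : Set ℝ))
  initial : IsC11 (f 0)
  equation : ∀ᵐ z ∂(volume.restrict (I ×ˢ (univ : Set ℝ))),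
    DifferentiableAt ℝ (Function.uncurry f) z ∧
      fderiv ℝ (Function.uncurry f) z (1, 0) - H (fderiv ℝ (Function.uncurry f) z (0, 1)) = 0
  semiconcave : ∃ c : ℝ, 0 < c ∧ ∀ t ∈ I, ConvexOn ℝ univ fun x => c * x ^ 2 - f t x

/-- Viscosity solution of `∂ₜ u - H(∂ₓ u) = 0` on `I × ℝ` with `u(0, ·) = u₀`. -/
structure IsViscositySolution (H : ℝ → ℝ) (I : Set ℝ) (u₀ : ℝ → ℝ) (u : ℝ → ℝ → ℝ) : Prop where
  continuousOn : ContinuousOn (Function.uncurry u) (I ×ˢ (univ : Set ℝ))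
  initial : u 0 = u₀
  subsolution : ∀ φ : ℝ × ℝ → ℝ, ContDiff ℝ 1 φ → ∀ z : ℝ × ℝ, z.1 ∈ interior I →
    IsLocalMax (fun w => Function.uncurry u w - φ w) z →
      fderiv ℝ φ z (1, 0) - H (fderiv ℝ φ z (0, 1)) ≤ 0
  supersolution : ∀ φ : ℝ × ℝ → ℝ, ContDiff ℝ 1 φ → ∀ z : ℝ × ℝ, z.1 ∈ interior I →
    IsLocalMin (fun w => Function.uncurry u w - φ w) z →
      0 ≤ fderiv ℝ φ z (1, 0) - H (fderiv ℝ φ z (0, 1))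

/-- The selection principle for the nonlinearity `H` (in one space dimension): on every
`[0, T] × ℝ`, a Lipschitz, uniformly semi-concave almost everywhere solution with `C^{1,1}`
initial datum is the viscosity solution. -/
def SelectionPrinciple (H : ℝ → ℝ) : Prop :=
  ∀ T : ℝ, 0 ≤ T → ∀ f : ℝ → ℝ → ℝ,
    IsSemiconcaveSolution H (Icc 0 T) f → IsViscositySolution H (Icc 0 T) (f 0) f

end HJCounterexample

/-!
The nonlinearity is `H(p) = p²/2 - 5/4 ((p - 1/2)₊³ + (-p - 1/2)₊³)`: it is concave on
`[11/10, 3/2]`, with `H(3/2) = -1/8 < H(0) = 0 < H(11/10) = 67/200` and `H' < 0` on that interval.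

A jump of `v` from `-q` to `q` at the origin is stationary because `H` is even. For `q = 3/2` the
chord of slope zero lies below the graph and the jump is admissible; it can form from Lipschitz
data, by the collision of a shock from `-3/2` to `0` with a shock from `0` to `3/2`. For
`q = 11/10` the chord lies above `H(0)` and the jump is not admissible, although characteristics
run into it from both sides. If the states next to the first jump are slowly lowered from `3/2`
to `11/10` by two incoming rarefaction fans, the jump persists, and the result is one-sided
Lipschitz but not entropic.

In terms of the primitive `f`, the first stage is the infimum `wedge` of the affine solutions
`a x + H(a) t + a²/2`, `|a| ≤ 3/2`. It is concave, has a `C^{1,1}` datum, and solves the equation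
wherever it is differentiable since its gradient is then that of the minimising affine function.
By `wedge_eq_abs`, which rests on `H(p) ≥ -p²/18` for `|p| ≤ 3/2`, it equals
`-3/2 |x| - t/8 + 9/8` for `|x| ≥ 3/2` and for `t ≥ 9`. The fan is a centred rarefaction,
the maximum over `q ∈ [11/10, 3/2]` of affine solutions; `fan` is its excess over the affine
solution of slope `-3/2`, and vanishes for `x - 25 ≤ -9/4 (t + 1)`. The counterexample is
`f(t, x) = wedge(t, x) + fan(t, |x|)`. Near every point off the axis either the second term
vanishes or the first is affine, so the sum is a solution (`equation_of_inner`,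
`equation_of_outer`). From time `99` on it is `67/200 t - 11/10 |x|` up to a constant, which
violates the subsolution property at `x = 0` as `H(0) < 67/200`.

For a Lipschitz semi-concave `f`, minus its right space derivative, `velocity f`, is defined
everywhere and one-sided Lipschitz; it is a weak solution of the conservation law because the
gradient of `f` is curl free (`integral_curl_eq_zero`). The entropy inequality fails for `E(p) = p²`
up to a constant, since the corresponding flux is odd and positive at `11/10`.
-/

namespace HJCounterexample

/-! ### Envelopes of affine functions -/

/-- A function that has a supergradient at every point of a set, depending continuously on the
point, is differentiable there: the errors made at the two ends of a segment control each other. -/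
theorem hasFDerivAt_of_supergradient {X : Type*} [NormedAddCommGroup X] [NormedSpace ℝ X]
    {g : X → ℝ} {L : X → X →L[ℝ] ℝ} {s : Set X} {z : X} (hs : s ∈ nhds z)
    (h : ∀ z ∈ s, ∀ w ∈ s, g w ≤ g z + L z (w - z)) (hL : ContinuousAt L z) :
    HasFDerivAt g (L z) z := by
  rw [hasFDerivAt_iff_isLittleO, Asymptotics.isLittleO_iff]
  intro ε hε
  filter_upwards [hs, Metric.continuousAt_iff'.1 hL ε hε] with w hw hd
  have h1 := h z (mem_of_mem_nhds hs) w hw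
  have h2 := h w hw z (mem_of_mem_nhds hs)
  have h3 : ‖(L w - L z) (w - z)‖ ≤ ε * ‖w - z‖ :=
    (ContinuousLinearMap.le_opNorm _ _).trans
      (mul_le_mul_of_nonneg_right (by rw [← dist_eq_norm]; exact hd.le) (norm_nonneg _))
  rw [Real.norm_eq_abs, abs_le] at h3
  simp only [sub_apply, map_sub] at h1 h2 h3 ⊢
  rw [Real.norm_eq_abs, abs_le]
  constructor <;> linarith [h3.1, h3.2]

/-- One-dimensional form of `hasFDerivAt_of_supergradient`. -/
theorem hasDerivAt_of_supergradient {g A : ℝ → ℝ} (hA : Continuous A)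
    (h : ∀ x y, g y ≤ g x + A x * (y - x)) (x : ℝ) : HasDerivAt g (A x) x := by
  have := hasFDerivAt_of_supergradient (g := g) (z := x) (s := univ)
    (L := fun x => ContinuousLinearMap.toSpanSingleton ℝ (A x)) Filter.univ_mem
    (fun z _ w _ => by simpa [mul_comm] using h z w) (by
      apply Continuous.continuousAt
      have : (fun x => ContinuousLinearMap.toSpanSingleton ℝ (A x))
          = fun x => A x • ContinuousLinearMap.toSpanSingleton ℝ (1 : ℝ) := by
        ext; simp
      rw [this]; fun_prop)
  simpa [hasDerivAt_iff_hasFDerivAt] using this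

theorem hasDerivAt_of_subgradient {g A : ℝ → ℝ} (hA : Continuous A)
    (h : ∀ x y, g x + A x * (y - x) ≤ g y) (x : ℝ) : HasDerivAt g (A x) x := by
  have := hasDerivAt_of_supergradient (g := fun x => -g x) (A := fun x => -A x) hA.neg
    (fun x y => by have := h x y; linarith) x
  simpa using this.fun_neg

/-- The gradient of a function at a point of differentiability is the only candidate
supergradient. -/
theorem fderiv_eq_of_supergradient {X : Type*} [NormedAddCommGroup X] [NormedSpace ℝ X]
    {g : X → ℝ} {L : X →L[ℝ] ℝ} {z : X} (hd : DifferentiableAt ℝ g z)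
    (h : ∀ w, g w ≤ g z + L (w - z)) : fderiv ℝ g z = L := by
  have hmin : IsLocalMin (fun w => L w - g w) z := by
    refine Filter.Eventually.of_forall fun w => ?_
    have := h w
    rw [map_sub] at this
    linarith
  have h1 := hmin.fderiv_eq_zero
  rw [fderiv_fun_sub L.differentiableAt hd, ContinuousLinearMap.fderiv, sub_eq_zero] at h1
  exact h1.symm

/-! ### The nonlinearity -/

theorem hasDerivAt_posPart_sq (x : ℝ) :
    HasDerivAt (fun x : ℝ => max x 0 ^ 2) (2 * max x 0) x := by
  refine hasDerivAt_of_subgradient (A := fun x => 2 * max x 0) (by fun_prop) (fun x y => ?_) x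
  rcases max_cases x 0 with ⟨hx, hx'⟩ | ⟨hx, hx'⟩ <;>
    rcases max_cases y 0 with ⟨hy, hy'⟩ | ⟨hy, hy'⟩ <;>
    simp only [hx, hy] <;> nlinarith [sq_nonneg (x - y)]

theorem hasDerivAt_posPart_cube (x : ℝ) :
    HasDerivAt (fun x : ℝ => max x 0 ^ 3) (3 * max x 0 ^ 2) x := by
  refine hasDerivAt_of_subgradient (A := fun x => 3 * max x 0 ^ 2) (by fun_prop)
    (fun x y => ?_) x
  have hx : max x 0 * (max x 0 - x) = 0 := by
    rcases max_cases x 0 with ⟨h, -⟩ | ⟨h, -⟩ <;> rw [h] <;> ring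
  have h0 := le_max_right x 0
  have h1 := le_max_right y 0
  have h2 := le_max_left y 0
  generalize max x 0 = u at *
  generalize max y 0 = w at *
  have e : w ^ 3 - u ^ 3 - 3 * u ^ 2 * (y - x)
      = (w - u) ^ 2 * (w + 2 * u) + 3 * u ^ 2 * (w - y) - 3 * u * (u * (u - x)) := by ring
  rw [hx] at e
  have : 0 ≤ (w - u) ^ 2 * (w + 2 * u) := by positivity
  have : 0 ≤ 3 * u ^ 2 * (w - y) := mul_nonneg (by positivity) (by linarith)
  linarith

theorem contDiff_posPart_cube : ContDiff ℝ 2 fun x : ℝ => max x 0 ^ 3 := by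
  have h1 : ContDiff ℝ 1 fun x : ℝ => max x 0 ^ 2 := by
    rw [contDiff_one_iff_deriv]
    refine ⟨fun x => (hasDerivAt_posPart_sq x).differentiableAt, ?_⟩
    rw [funext fun x => (hasDerivAt_posPart_sq x).deriv]
    fun_prop
  have : (2 : WithTop ℕ∞) = 1 + 1 := by norm_num
  rw [this, contDiff_succ_iff_deriv]
  refine ⟨fun x => (hasDerivAt_posPart_cube x).differentiableAt, by simp, ?_⟩
  rw [funext fun x => (hasDerivAt_posPart_cube x).deriv]
  fun_prop

theorem nonlinearity_eq (p : ℝ) :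
    nonlinearity p = p ^ 2 / 2 - 5 / 4 * (max (p - 1 / 2) 0 ^ 3 + max (-p - 1 / 2) 0 ^ 3) := by
  unfold nonlinearity
  split_ifs with h1 h2
  · rw [max_eq_right (by linarith : p - 1 / 2 ≤ 0), max_eq_left (by linarith)]; ring
  · rw [max_eq_right (by linarith : p - 1 / 2 ≤ 0), max_eq_right (by linarith)]; ring
  · rw [max_eq_left (by linarith : 0 ≤ p - 1 / 2), max_eq_right (by linarith)]; ring

theorem contDiff_nonlinearity : ContDiff ℝ 2 nonlinearity := by
  rw [funext nonlinearity_eq]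
  have h1 : ContDiff ℝ 2 fun p : ℝ => max (p - 1 / 2) 0 ^ 3 :=
    contDiff_posPart_cube.comp (by fun_prop : ContDiff ℝ 2 fun p : ℝ => p - 1 / 2)
  have h2 : ContDiff ℝ 2 fun p : ℝ => max (-p - 1 / 2) 0 ^ 3 :=
    contDiff_posPart_cube.comp (by fun_prop : ContDiff ℝ 2 fun p : ℝ => -p - 1 / 2)
  fun_prop

theorem continuous_nonlinearity : Continuous nonlinearity := contDiff_nonlinearity.continuous

theorem even_nonlinearity : Function.Even nonlinearity := by
  intro p
  rw [nonlinearity_eq, nonlinearity_eq, neg_neg]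
  ring

theorem nonlinearity_le (p : ℝ) : nonlinearity p ≤ p ^ 2 / 2 := by
  rw [nonlinearity_eq]
  have h1 : 0 ≤ max (p - 1 / 2) 0 ^ 3 := pow_nonneg (le_max_right _ _) _
  have h2 : 0 ≤ max (-p - 1 / 2) 0 ^ 3 := pow_nonneg (le_max_right _ _) _
  linarith

theorem nonlinearity_of_half_le {p : ℝ} (hp : 1 / 2 ≤ p) :
    nonlinearity p = p ^ 2 / 2 - 5 / 4 * (p - 1 / 2) ^ 3 := by
  rw [nonlinearity_eq, max_eq_left (by linarith), max_eq_right (by linarith)]; ring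

theorem nonlinearity_zero : nonlinearity 0 = 0 := by norm_num [nonlinearity]

theorem not_convexOn_nonlinearity : ¬ ConvexOn ℝ univ nonlinearity := by
  intro h
  have := h.2 (mem_univ (-(3 / 2) : ℝ)) (mem_univ (3 / 2 : ℝ))
    (by norm_num : (0 : ℝ) ≤ 1 / 2) (by norm_num : (0 : ℝ) ≤ 1 / 2) (by norm_num)
  norm_num [nonlinearity] at this

/-- The parabola `-p² / 18` meets the graph at `p = ±3/2` and lies below it in between, so that
`(3/2, H(3/2))` and `(-3/2, H(3/2))` are joined by an admissible chord. -/
theorem neg_sq_div_le_nonlinearity {p : ℝ} (h1 : -(3 / 2) ≤ p) (h2 : p ≤ 3 / 2) :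
    -(p ^ 2 / 18) ≤ nonlinearity p := by
  have key : ∀ q : ℝ, 0 ≤ q → q ≤ 3 / 2 → -(q ^ 2 / 18) ≤ nonlinearity q := by
    intro q hq hq'
    rcases le_total q (1 / 2) with h | h
    · rw [nonlinearity_eq, max_eq_right (by linarith), max_eq_right (by linarith)]
      nlinarith [sq_nonneg q]
    · rw [nonlinearity_of_half_le h]
      -- with `s = q - 1/2 ∈ [0, 1]`, the bound is `5/9 (s + 1/2)² ≥ 5/4 s³`
      obtain ⟨s, rfl⟩ : ∃ s, q = s + 1 / 2 := ⟨q - 1 / 2, by ring⟩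
      have hs : 0 ≤ s := by linarith
      have hs' : s ≤ 1 := by linarith
      nlinarith [mul_nonneg (mul_nonneg hs hs) (sub_nonneg.2 hs'),
        mul_nonneg hs (sub_nonneg.2 hs')]
  rcases le_total 0 p with h | h
  · exact key p h h2
  · have := key (-p) (by linarith) (by linarith)
    rwa [even_nonlinearity, neg_sq] at this

/-- Concavity of the nonlinearity on `[11/10, 3/2]`, in terms of tangent lines. -/
theorem nonlinearity_le_tangent {p q : ℝ} (hp : 11 / 10 ≤ p) (hq : 11 / 10 ≤ q) :
    nonlinearity p ≤ nonlinearity q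
      + (-(15 / 4) * q ^ 2 + 19 / 4 * q - 15 / 16) * (p - q) := by
  rw [nonlinearity_of_half_le (by linarith), nonlinearity_of_half_le (by linarith)]
  have : 0 ≤ (p - q) ^ 2 * (5 / 2 * q + 5 / 4 * p - 19 / 8) :=
    mul_nonneg (sq_nonneg _) (by linarith)
  linarith [show q ^ 2 / 2 - 5 / 4 * (q - 1 / 2) ^ 3
      + (-(15 / 4) * q ^ 2 + 19 / 4 * q - 15 / 16) * (p - q) - (p ^ 2 / 2 - 5 / 4 * (p - 1 / 2) ^ 3)
      = (p - q) ^ 2 * (5 / 2 * q + 5 / 4 * p - 19 / 8) by ring]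

/-! ### From a semi-concave function to a solution of the conservation law -/

/-- Minus the right space derivative. For a function that is semi-concave in space this is
defined everywhere, including at the kinks. -/
noncomputable def velocity (f : ℝ → ℝ → ℝ) (t x : ℝ) : ℝ :=
  -derivWithin (f t) (Ioi x) x

theorem hasDerivWithinAt_of_semiconcave {g : ℝ → ℝ} {c : ℝ}
    (hg : ConvexOn ℝ univ fun x => c * x ^ 2 - g x) (x : ℝ) :
    HasDerivWithinAt g (2 * c * x - derivWithin (fun x => c * x ^ 2 - g x) (Ioi x) x)
      (Ioi x) x := by
  have h1 := hg.hasDerivWithinAt_rightDeriv_of_mem_interior (x := x) (by simp)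
  have h2 : HasDerivAt (fun x : ℝ => c * x ^ 2) (2 * c * x) x := by
    refine ((hasDerivAt_pow 2 x).const_mul c).congr_deriv ?_
    simp [mul_left_comm, mul_assoc]
  simpa using h2.hasDerivWithinAt.fun_sub h1

theorem velocity_eq_of_hasDerivWithinAt {f : ℝ → ℝ → ℝ} {t x d : ℝ}
    (h : HasDerivWithinAt (f t) d (Ioi x) x) : velocity f t x = -d := by
  rw [velocity, h.derivWithin (uniqueDiffWithinAt_Ioi x)]

section Velocity

variable {f : ℝ → ℝ → ℝ} {c : ℝ} {K : NNReal}

theorem hasDerivWithinAt_velocity {t : ℝ} (hc : ConvexOn ℝ univ fun x => c * x ^ 2 - f t x)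
    (x : ℝ) : HasDerivWithinAt (f t) (-velocity f t x) (Ioi x) x := by
  have h := hasDerivWithinAt_of_semiconcave hc x
  rw [velocity_eq_of_hasDerivWithinAt h, neg_neg]
  exact h

theorem oneSidedLipschitzWith_velocity {t : ℝ}
    (hc : ConvexOn ℝ univ fun x => c * x ^ 2 - f t x) :
    OneSidedLipschitzWith (2 * c) (velocity f t) := by
  intro x y hyx
  have h := hc.monotoneOn_rightDeriv (by simp) (by simp) hyx
  rw [velocity_eq_of_hasDerivWithinAt (hasDerivWithinAt_of_semiconcave hc x),
    velocity_eq_of_hasDerivWithinAt (hasDerivWithinAt_of_semiconcave hc y)]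
  simp only at h
  linarith

theorem tendsto_velocity {t : ℝ} (hc : ConvexOn ℝ univ fun x => c * x ^ 2 - f t x) (x : ℝ) :
    Filter.Tendsto (fun n : ℕ => -slope (f t) x (x + 1 / ((n : ℝ) + 1))) Filter.atTop
      (nhds (velocity f t x)) := by
  have h := (hasDerivWithinAt_iff_tendsto_slope' (by simp)).1 (hasDerivWithinAt_velocity hc x)
  have h1 : Filter.Tendsto (fun n : ℕ => x + 1 / ((n : ℝ) + 1)) Filter.atTop
      (nhdsWithin x (Ioi x)) := by
    refine tendsto_nhdsWithin_iff.2 ⟨?_, Filter.Eventually.of_forall fun n => ?_⟩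
    · simpa using tendsto_one_div_add_atTop_nhds_zero_nat.const_add x
    · have : (0 : ℝ) < 1 / ((n : ℝ) + 1) := by positivity
      simpa using this
  simpa using (h.comp h1).neg

theorem measurable_velocity (hf : Continuous (Function.uncurry f))
    (hc : ∀ t, ConvexOn ℝ univ fun x => c * x ^ 2 - f t x) :
    Measurable (Function.uncurry (velocity f)) := by
  refine measurable_of_tendsto_metrizable
    (f := fun (n : ℕ) (z : ℝ × ℝ) => -slope (f z.1) z.2 (z.2 + 1 / ((n : ℝ) + 1))) (fun n => ?_)
    (tendsto_pi_nhds.2 fun z => tendsto_velocity (hc z.1) z.2)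
  have h1 : Continuous fun z : ℝ × ℝ => f z.1 (z.2 + 1 / ((n : ℝ) + 1)) :=
    hf.comp (by fun_prop : Continuous fun z : ℝ × ℝ => (z.1, z.2 + 1 / ((n : ℝ) + 1)))
  have h2 : Continuous fun z : ℝ × ℝ => f z.1 z.2 := hf
  simp only [slope_def_field, add_sub_cancel_left]
  exact (by fun_prop : Continuous _).measurable

theorem lipschitzWith_of_uncurry (hf : LipschitzWith K (Function.uncurry f)) (t : ℝ) :
    LipschitzWith K (f t) := by
  have := hf.comp (LipschitzWith.prodMk_left (β := ℝ) t)
  simpa [Function.comp_def, Function.uncurry] using this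

theorem abs_velocity_le (hf : LipschitzWith K (Function.uncurry f)) {t : ℝ}
    (hc : ConvexOn ℝ univ fun x => c * x ^ 2 - f t x) (x : ℝ) : |velocity f t x| ≤ K := by
  refine le_of_tendsto (tendsto_velocity hc x).abs (Filter.Eventually.of_forall fun n => ?_)
  have h := (lipschitzWith_of_uncurry hf t).dist_le_mul (x + 1 / ((n : ℝ) + 1)) x
  have hn : (0 : ℝ) < 1 / ((n : ℝ) + 1) := by positivity
  rw [abs_neg, slope_def_field, abs_div, div_le_iff₀ (by simpa using hn.ne')]
  simpa [Real.dist_eq] using h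

theorem integral_velocity (hf : LipschitzWith K (Function.uncurry f))
    (hc : ∀ t, ConvexOn ℝ univ fun x => c * x ^ 2 - f t x) (t a b : ℝ) :
    f t b - f t a = -∫ y in a..b, velocity f t y := by
  rw [← intervalIntegral.integral_neg]
  refine (intervalIntegral.integral_eq_sub_of_hasDeriv_right
    (lipschitzWith_of_uncurry hf t).continuous.continuousOn
    (fun x _ => hasDerivWithinAt_velocity (hc t) x) ?_).symm
  have hm : Measurable (velocity f t) :=
    (measurable_velocity hf.continuous hc).comp measurable_prodMk_left
  refine (intervalIntegrable_const (c := (K : ℝ))).mono_fun hm.neg.aestronglyMeasurable ?_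
  refine Filter.Eventually.of_forall fun x => ?_
  simpa using abs_velocity_le hf (hc t) x

theorem velocity_eq_fderiv {z : ℝ × ℝ} (hd : DifferentiableAt ℝ (Function.uncurry f) z) :
    velocity f z.1 z.2 = -fderiv ℝ (Function.uncurry f) z (0, 1) := by
  have h := hd.hasFDerivAt.comp_hasDerivAt z.2
    ((hasDerivAt_const z.2 z.1).prodMk (hasDerivAt_id z.2))
  exact velocity_eq_of_hasDerivWithinAt (HasDerivAt.hasDerivWithinAt h)

theorem velocity_eq_deriv {t x : ℝ} (hd : DifferentiableAt ℝ (f t) x) :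
    velocity f t x = -deriv (f t) x :=
  velocity_eq_of_hasDerivWithinAt hd.hasDerivAt.hasDerivWithinAt

theorem ae_fst_ne (a : ℝ) : ∀ᵐ z : ℝ × ℝ, z.1 ≠ a :=
  Measure.quasiMeasurePreserving_fst.ae (Measure.ae_ne volume a)

theorem ae_snd_ne (a : ℝ) : ∀ᵐ z : ℝ × ℝ, z.2 ≠ a :=
  Measure.quasiMeasurePreserving_snd.ae (Measure.ae_ne volume a)

theorem integrable_fderiv_mul {g φ : ℝ × ℝ → ℝ} (hg : LipschitzWith K g) (hφ : ContDiff ℝ ∞ φ)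
    (hs : HasCompactSupport φ) (v w : ℝ × ℝ) :
    Integrable fun z => fderiv ℝ g z v * fderiv ℝ φ z w := by
  have h1 : Integrable fun z => fderiv ℝ φ z w :=
    ((hφ.continuous_fderiv (by simp)).clm_apply continuous_const).integrable_of_hasCompactSupport
      (hs.fderiv_apply ℝ w)
  refine h1.bdd_mul (c := K * ‖v‖) (measurable_fderiv_apply_const ℝ g v).aestronglyMeasurable
    (Filter.Eventually.of_forall fun z => ?_)
  exact (ContinuousLinearMap.le_opNorm _ _).trans
    (mul_le_mul_of_nonneg_right (norm_fderiv_le_of_lipschitz ℝ hg) (norm_nonneg _))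

theorem integral_fderiv_mul_fderiv {g φ : ℝ × ℝ → ℝ} (hg : LipschitzWith K g)
    (hφ : ContDiff ℝ ∞ φ) (hs : HasCompactSupport φ) (v w : ℝ × ℝ) :
    ∫ z, fderiv ℝ g z v * fderiv ℝ φ z w = -∫ z, fderiv ℝ (fderiv ℝ φ) z v w * g z := by
  have hd : ContDiff ℝ ∞ (fderiv ℝ φ) := hφ.fderiv_right (by simp)
  have hψ : ContDiff ℝ ∞ fun z => fderiv ℝ φ z w := hd.clm_apply contDiff_const
  obtain ⟨D, hD⟩ := ContDiff.lipschitzWith_of_hasCompactSupport (hs.fderiv_apply ℝ w) hψ (by simp)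
  have h := hg.integral_lineDeriv_mul_eq (μ := volume) hD (hs.fderiv_apply ℝ w) v
  rw [← integral_neg]
  refine Eq.trans (integral_congr_ae ?_) (h.trans (integral_congr_ae ?_))
  · filter_upwards [hg.ae_differentiableAt] with z hz
    rw [hz.lineDeriv_eq_fderiv]
  · refine Filter.Eventually.of_forall fun z => ?_
    have h1 : DifferentiableAt ℝ (fun z => fderiv ℝ φ z w) z :=
      (hψ.differentiable (by simp)).differentiableAt
    have h2 : DifferentiableAt ℝ (fderiv ℝ φ) z := (hd.differentiable (by simp)).differentiableAt
    simp only
    rw [h1.lineDeriv_eq_fderiv, fderiv_clm_apply h2 (differentiableAt_const w)]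
    simp

/-- The gradient of a Lipschitz function is curl free in the sense of distributions. -/
theorem integral_curl_eq_zero {g φ : ℝ × ℝ → ℝ} (hg : LipschitzWith K g)
    (hφ : ContDiff ℝ ∞ φ) (hs : HasCompactSupport φ) :
    ∫ z, (fderiv ℝ g z (1, 0) * fderiv ℝ φ z (0, 1) - fderiv ℝ g z (0, 1) * fderiv ℝ φ z (1, 0))
      = 0 := by
  rw [integral_sub (integrable_fderiv_mul hg hφ hs _ _) (integrable_fderiv_mul hg hφ hs _ _),
    integral_fderiv_mul_fderiv hg hφ hs, integral_fderiv_mul_fderiv hg hφ hs]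
  have : ∀ z, fderiv ℝ (fderiv ℝ φ) z (1, 0) (0, 1) = fderiv ℝ (fderiv ℝ φ) z (0, 1) (1, 0) :=
    fun z => (hφ.contDiffAt.isSymmSndFDerivAt
      (by simpa using WithTop.coe_le_coe.2 (le_top : (2 : ℕ∞) ≤ ⊤))) _ _
  simp [this]

theorem hasFDerivAt_of_frozen (h0 : Differentiable ℝ (f 0)) (hfr : ∀ t ≤ 0, f t = f 0)
    {z : ℝ × ℝ} (hz : z.1 < 0) :
    HasFDerivAt (Function.uncurry f)
      ((deriv (f 0) z.2) • (ContinuousLinearMap.snd ℝ ℝ ℝ)) z := by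
  have h : HasFDerivAt (fun w : ℝ × ℝ => f 0 w.2)
      ((deriv (f 0) z.2) • (ContinuousLinearMap.snd ℝ ℝ ℝ)) z :=
    (h0 z.2).hasDerivAt.comp_hasFDerivAt z hasFDerivAt_snd
  refine h.congr_of_eventuallyEq ?_
  filter_upwards [(isOpen_Iio.preimage continuous_fst).mem_nhds hz] with w hw
  simp only [Function.uncurry]
  rw [hfr w.1 (le_of_lt hw)]

/-- Over negative times, the pairing with a function frozen at time `0` is a boundary term. -/
theorem setIntegral_frozen {g : ℝ → ℝ} (hg : Continuous g) {φ : ℝ × ℝ → ℝ}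
    (hφ : ContDiff ℝ ∞ φ) (hs : HasCompactSupport φ) :
    ∫ z in Iic (0 : ℝ) ×ˢ (univ : Set ℝ), g z.2 * fderiv ℝ φ z (1, 0) = ∫ x, g x * φ (0, x) := by
  have hint : Integrable fun z : ℝ × ℝ => g z.2 * fderiv ℝ φ z (1, 0) := by
    refine Continuous.integrable_of_hasCompactSupport ?_ ((hs.fderiv_apply ℝ (1, 0)).mul_left)
    have := (hφ.continuous_fderiv (by simp)).clm_apply (continuous_const (y := ((1, 0) : ℝ × ℝ)))
    fun_prop
  have hr : (volume : Measure (ℝ × ℝ)).restrict (Iic (0 : ℝ) ×ˢ univ)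
      = ((volume : Measure ℝ).restrict (Iic 0)).prod volume := by
    rw [Measure.volume_eq_prod, ← Measure.prod_restrict, Measure.restrict_univ]
  rw [hr, integral_prod_symm _ (by rw [← hr]; exact hint.integrableOn)]
  refine integral_congr_ae (Filter.Eventually.of_forall fun x => ?_)
  simp only
  rw [integral_const_mul]
  congr 1
  have hemb : Topology.IsClosedEmbedding fun t : ℝ => (t, x) :=
    (Isometry.of_dist_eq fun a b => by simp [Prod.dist_eq]).isClosedEmbedding
  have h1 : ContDiff ℝ 1 fun t : ℝ => φ (t, x) :=
    (hφ.of_le (by simp)).comp (by fun_prop : ContDiff ℝ 1 fun t : ℝ => (t, x))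
  have h2 : HasCompactSupport fun t : ℝ => φ (t, x) := hs.comp_isClosedEmbedding hemb
  rw [← h2.integral_Iic_deriv_eq h1 0]
  refine integral_congr_ae (Filter.Eventually.of_forall fun t => ?_)
  have h3 := ((hφ.differentiable (by simp)) (t, x)).hasFDerivAt.comp_hasDerivAt t
    ((hasDerivAt_id t).prodMk (hasDerivAt_const t x))
  exact (HasDerivAt.deriv h3).symm

/-- If `f` solves `∂ₜ f = H(∂ₓ f)` almost everywhere, then `v = -∂ₓ f` solves
`∂ₜ v + ∂ₓ (H v) = 0`: this is the vanishing of the curl of `∇ f`, the extension of `f` by its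
initial datum to negative times producing the initial condition. -/
theorem isWeakSolution_velocity {H : ℝ → ℝ} (hH : Function.Even H)
    (hf : LipschitzWith K (Function.uncurry f))
    (hc : ∀ t, ConvexOn ℝ univ fun x => c * x ^ 2 - f t x)
    (hfr : ∀ t ≤ 0, f t = f 0) (hs : IsSemiconcaveSolution H (Ici 0) f) :
    IsWeakSolution H (velocity f 0) (velocity f) where
  measurable := measurable_velocity hf.continuous hc
  bounded := ⟨K, fun t _ x => abs_velocity_le hf (hc t) x⟩
  weak φ hφ hφs := by
    obtain ⟨h0, L, hL⟩ := hs.initial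
    have hv0 : velocity f 0 = fun x => -deriv (f 0) x := funext fun x => velocity_eq_deriv (h0 x)
    have hmeas : MeasurableSet (Ioi (0 : ℝ) ×ˢ (univ : Set ℝ)) := measurableSet_Ioi.prod .univ
    have hcompl : (Ioi (0 : ℝ) ×ˢ (univ : Set ℝ))ᶜ = Iic (0 : ℝ) ×ˢ (univ : Set ℝ) := by
      ext z; simp
    have hcurl := integral_curl_eq_zero hf hφ hφs
    have hint : Integrable fun z : ℝ × ℝ =>
        fderiv ℝ (Function.uncurry f) z (1, 0) * fderiv ℝ φ z (0, 1)
          - fderiv ℝ (Function.uncurry f) z (0, 1) * fderiv ℝ φ z (1, 0) :=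
      (integrable_fderiv_mul hf hφ hφs _ _).sub (integrable_fderiv_mul hf hφ hφs _ _)
    rw [← integral_add_compl hmeas hint, hcompl] at hcurl
    have h2 : ∫ z in Iic (0 : ℝ) ×ˢ (univ : Set ℝ),
        (fderiv ℝ (Function.uncurry f) z (1, 0) * fderiv ℝ φ z (0, 1)
          - fderiv ℝ (Function.uncurry f) z (0, 1) * fderiv ℝ φ z (1, 0))
        = ∫ x, velocity f 0 x * φ (0, x) := by
      rw [← setIntegral_frozen (by rw [hv0]; exact hL.continuous.neg) hφ hφs]
      refine setIntegral_congr_ae (measurableSet_Iic.prod .univ) ?_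
      filter_upwards [ae_fst_ne 0] with z hz hz'
      rw [(hasFDerivAt_of_frozen h0 hfr (lt_of_le_of_ne hz'.1 hz)).fderiv, hv0]
      simp
    have h1 : ∫ z in Ioi (0 : ℝ) ×ˢ (univ : Set ℝ),
        (velocity f z.1 z.2 * fderiv ℝ φ z (1, 0) + H (velocity f z.1 z.2) * fderiv ℝ φ z (0, 1))
        = ∫ z in Ioi (0 : ℝ) ×ˢ (univ : Set ℝ),
        (fderiv ℝ (Function.uncurry f) z (1, 0) * fderiv ℝ φ z (0, 1)
          - fderiv ℝ (Function.uncurry f) z (0, 1) * fderiv ℝ φ z (1, 0)) := by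
      have hae := ae_mono (Measure.restrict_mono
        (prod_mono_left (t := (univ : Set ℝ)) (Ioi_subset_Ici_self (a := (0 : ℝ)))) le_rfl)
        hs.equation
      refine integral_congr_ae ?_
      filter_upwards [hae] with z hz
      rw [velocity_eq_fderiv hz.1, hH, sub_eq_zero.1 hz.2]
      ring
    rw [weakPairing, h1, ← h2]
    exact hcurl

end Velocity

/-! ### Convexity and Lipschitz bounds from subgradients -/

theorem convexOn_of_exists_subgradient {g : ℝ → ℝ} (h : ∀ x, ∃ A, ∀ y, g x + A * (y - x) ≤ g y) :
    ConvexOn ℝ univ g := by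
  refine ⟨convex_univ, fun x _ y _ a b ha hb hab => ?_⟩
  obtain ⟨A, hA⟩ := h (a • x + b • y)
  have h1 := mul_le_mul_of_nonneg_left (hA x) ha
  have h2 := mul_le_mul_of_nonneg_left (hA y) hb
  simp only [smul_eq_mul] at *
  obtain rfl : b = 1 - a := by linarith
  linarith [show a * (g (a * x + (1 - a) * y) + A * (x - (a * x + (1 - a) * y)))
    + (1 - a) * (g (a * x + (1 - a) * y) + A * (y - (a * x + (1 - a) * y)))
    = g (a * x + (1 - a) * y) by ring]

theorem lipschitzOnWith_of_supergradient {g : ℝ × ℝ → ℝ} {s : Set (ℝ × ℝ)}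
    (h : ∀ z ∈ s, ∃ p q : ℝ, |p| ≤ 3 / 2 ∧ |q| ≤ 3 / 2 ∧
      ∀ w ∈ s, g w ≤ g z + (p * (w.1 - z.1) + q * (w.2 - z.2))) :
    LipschitzOnWith 3 g s := by
  refine LipschitzOnWith.of_le_add_mul 3 fun w hw z hz => ?_
  obtain ⟨p, q, hp, hq, hpq⟩ := h z hz
  refine (hpq w hw).trans ?_
  have h1 : |w.1 - z.1| ≤ dist w z := by rw [← Real.dist_eq]; exact le_max_left _ _
  have h2 : |w.2 - z.2| ≤ dist w z := by rw [← Real.dist_eq]; exact le_max_right _ _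
  have h3 : p * (w.1 - z.1) ≤ 3 / 2 * dist w z := by
    refine (le_abs_self _).trans ?_
    rw [abs_mul]
    exact mul_le_mul hp h1 (abs_nonneg _) (by norm_num)
  have h4 : q * (w.2 - z.2) ≤ 3 / 2 * dist w z := by
    refine (le_abs_self _).trans ?_
    rw [abs_mul]
    exact mul_le_mul hq h2 (abs_nonneg _) (by norm_num)
  simp only [NNReal.coe_ofNat]
  linarith

/-- The linear form `(t, x) ↦ p t + q x`. -/
noncomputable def gradientForm (p q : ℝ) : ℝ × ℝ →L[ℝ] ℝ :=
  p • ContinuousLinearMap.fst ℝ ℝ ℝ + q • ContinuousLinearMap.snd ℝ ℝ ℝ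

@[simp] theorem gradientForm_apply (p q : ℝ) (z : ℝ × ℝ) :
    gradientForm p q z = p * z.1 + q * z.2 := by
  simp [gradientForm]

/-! ### The colliding shocks: an infimum of affine solutions -/

/-- The affine solution `a x + H(a) t + a² / 2` of the Hamilton-Jacobi equation. -/
noncomputable def plane (a t x : ℝ) : ℝ := a * x + nonlinearity a * t + a ^ 2 / 2

/-- The infimum of the affine solutions with slope in `[-3/2, 3/2]`. At time `0` it is `-x² / 2`
continued by its tangent lines at `±3/2`; from time `9` on it is the wedge
`-3/2 |x| - t / 8 + 9 / 8`. -/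
noncomputable def wedge (t x : ℝ) : ℝ :=
  sInf ((fun a => plane a t x) '' Icc (-(3 / 2)) (3 / 2))

theorem continuous_plane (t x : ℝ) : Continuous fun a => plane a t x := by
  unfold plane
  have := continuous_nonlinearity
  fun_prop

theorem exists_wedge_eq (t x : ℝ) :
    ∃ a ∈ Icc (-(3 / 2) : ℝ) (3 / 2), wedge t x = plane a t x ∧
      ∀ b ∈ Icc (-(3 / 2) : ℝ) (3 / 2), plane a t x ≤ plane b t x :=
  isCompact_Icc.exists_sInf_image_eq_and_le (nonempty_Icc.2 (by norm_num))
    (continuous_plane t x).continuousOn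

theorem wedge_le {a : ℝ} (ha : a ∈ Icc (-(3 / 2) : ℝ) (3 / 2)) (t x : ℝ) :
    wedge t x ≤ plane a t x := by
  obtain ⟨b, -, hb, h⟩ := exists_wedge_eq t x
  exact hb.trans_le (h a ha)

theorem wedge_supergradient (t x : ℝ) : ∃ a ∈ Icc (-(3 / 2) : ℝ) (3 / 2),
    ∀ s y, wedge s y ≤ wedge t x + (nonlinearity a * (s - t) + a * (y - x)) := by
  obtain ⟨a, ha, he, -⟩ := exists_wedge_eq t x
  refine ⟨a, ha, fun s y => (wedge_le ha s y).trans_eq ?_⟩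
  rw [he, plane, plane]; ring

theorem nonlinearity_bounds {a : ℝ} (ha : a ∈ Icc (-(3 / 2) : ℝ) (3 / 2)) :
    -(1 / 8) ≤ nonlinearity a ∧ nonlinearity a ≤ 9 / 8 := by
  have h1 := neg_sq_div_le_nonlinearity ha.1 ha.2
  have h2 := nonlinearity_le a
  have h3 : a ^ 2 ≤ 9 / 4 := by nlinarith [ha.1, ha.2]
  constructor <;> linarith

theorem lipschitzWith_wedge : LipschitzWith 3 (Function.uncurry wedge) := by
  rw [← lipschitzOnWith_univ]
  refine lipschitzOnWith_of_supergradient fun z _ => ?_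
  obtain ⟨a, ha, h⟩ := wedge_supergradient z.1 z.2
  have := nonlinearity_bounds ha
  exact ⟨nonlinearity a, a, abs_le.2 ⟨by linarith, by linarith⟩, abs_le.2 ha,
    fun w _ => h w.1 w.2⟩

theorem convexOn_neg_wedge (t : ℝ) : ConvexOn ℝ univ fun x => -wedge t x := by
  refine convexOn_of_exists_subgradient fun x => ?_
  obtain ⟨a, -, h⟩ := wedge_supergradient t x
  refine ⟨-a, fun y => ?_⟩
  have := h t y
  simp only [sub_self, mul_zero, zero_add] at this
  linarith

theorem wedge_neg (t x : ℝ) : wedge t (-x) = wedge t x := by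
  have key : ∀ x, wedge t (-x) ≤ wedge t x := by
    intro x
    obtain ⟨a, ha, he, -⟩ := exists_wedge_eq t x
    refine (wedge_le (a := -a) ⟨by linarith [ha.2], by linarith [ha.1]⟩ t (-x)).trans_eq ?_
    rw [he, plane, plane, even_nonlinearity]; ring
  refine le_antisymm (key x) ?_
  simpa using key (-x)

theorem nonlinearity_three_halves : nonlinearity (3 / 2) = -(1 / 8) := by norm_num [nonlinearity]

/-- Where the affine solution of slope `-3/2` is the minimising one on the right half-line. At time
`9` the gain `(H(a) - H(3/2)) t ≥ (9/4 - a²) t / 18` makes up for the difference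
`(9/4 - a²) / 2` of the constants. -/
theorem wedge_eq {t x : ℝ} (ht : 0 ≤ t) (hx : 0 ≤ x) (h : 3 / 2 ≤ x ∨ 9 ≤ t) :
    wedge t x = -(3 / 2) * x - t / 8 + 9 / 8 := by
  refine le_antisymm ?_ ?_
  · refine (wedge_le (a := -(3 / 2)) ⟨le_rfl, by norm_num⟩ t x).trans_eq ?_
    rw [plane, even_nonlinearity, nonlinearity_three_halves]; ring
  · obtain ⟨a, ha, he, -⟩ := exists_wedge_eq t x
    rw [he, plane]
    have h1 := neg_sq_div_le_nonlinearity ha.1 ha.2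
    have ha1 : 0 ≤ a + 3 / 2 := by linarith [ha.1]
    have ha2 : 0 ≤ 3 / 2 - a := by linarith [ha.2]
    have hd := mul_nonneg ha1 ha2
    rcases h with h | h
    · have h2 : 0 ≤ (nonlinearity a + 1 / 8) * t :=
        mul_nonneg (by linarith [(nonlinearity_bounds ha).1]) ht
      have h3 : 0 ≤ (a + 3 / 2) * (x - (3 / 2 - a) / 2) := mul_nonneg ha1 (by linarith)
      linarith
    · have h2 : (9 / 4 - a ^ 2) / 18 * t ≤ (nonlinearity a + 1 / 8) * t :=
        mul_le_mul_of_nonneg_right (by linarith) ht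
      have h3 : 0 ≤ (a + 3 / 2) * (3 / 2 - a) * (t - 9) := mul_nonneg hd (by linarith)
      have h4 := mul_nonneg ha1 hx
      linarith

theorem wedge_eq_abs {t x : ℝ} (ht : 0 ≤ t) (h : 3 / 2 ≤ |x| ∨ 9 ≤ t) :
    wedge t x = -(3 / 2) * |x| - t / 8 + 9 / 8 := by
  rw [← wedge_eq ht (abs_nonneg x) h]
  rcases abs_choice x with hx | hx <;> rw [hx]
  rw [wedge_neg]

/-- The nearest point to `x` in `[-3/2, 3/2]`. -/
noncomputable def clampSlope (x : ℝ) : ℝ := max (-(3 / 2)) (min (3 / 2) x)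

theorem lipschitzWith_clampSlope : LipschitzWith 1 clampSlope :=
  (LipschitzWith.id.const_min _).const_max _

theorem hasDerivAt_wedge_zero (x : ℝ) : HasDerivAt (wedge 0) (-clampSlope x) x := by
  refine hasDerivAt_of_supergradient (A := fun x => -clampSlope x)
    lipschitzWith_clampSlope.continuous.neg (fun x y => ?_) x
  have hmem : -clampSlope x ∈ Icc (-(3 / 2) : ℝ) (3 / 2) := by
    unfold clampSlope
    refine ⟨neg_le_neg (max_le (by norm_num) (min_le_left _ _)), ?_⟩
    linarith [le_max_left (-(3 / 2) : ℝ) (min (3 / 2) x)]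
  refine (wedge_le hmem 0 y).trans ?_
  obtain ⟨a, ha, he, -⟩ := exists_wedge_eq 0 x
  rw [he, plane, plane]
  -- the variational inequality characterising the projection onto `[-3/2, 3/2]`
  have hvar : 0 ≤ (a + clampSlope x) * (x - clampSlope x) := by
    unfold clampSlope
    rcases max_cases (-(3 / 2) : ℝ) (min (3 / 2) x) with ⟨h1, h2⟩ | ⟨h1, h2⟩ <;>
    rw [h1] <;> rcases min_cases (3 / 2 : ℝ) x with ⟨h3, h4⟩ | ⟨h3, h4⟩ <;>
    simp only [h3] at h2 ⊢ <;> nlinarith [ha.1, ha.2]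
  nlinarith [sq_nonneg (a + clampSlope x)]

/-! ### The rarefaction fan -/

/-- The state `q` of the fan at similarity variable `y`: the solution of `H'(q) = y` in the
concave region, truncated to `[11/10, 3/2]`, which corresponds to `y ∈ [-9/4, -1/4]`. -/
noncomputable def fanState (y : ℝ) : ℝ :=
  (19 + 2 * √(max 49 (min 169 (34 - 60 * y)))) / 30

theorem fanState_mem (y : ℝ) : fanState y ∈ Icc (11 / 10 : ℝ) (3 / 2) := by
  have h1 : (7 : ℝ) ≤ √(max 49 (min 169 (34 - 60 * y))) :=
    Real.le_sqrt_of_sq_le (by norm_num)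
  have h2 : √(max 49 (min 169 (34 - 60 * y))) ≤ 13 :=
    Real.sqrt_le_iff.2 ⟨by norm_num, by norm_num⟩
  unfold fanState
  constructor <;> linarith

theorem fanState_of_le {y : ℝ} (hy : y ≤ -(9 / 4)) : fanState y = 3 / 2 := by
  rw [fanState, min_eq_left (by linarith), max_eq_right (by norm_num),
    show (169 : ℝ) = 13 ^ 2 by norm_num, Real.sqrt_sq (by norm_num)]
  norm_num

theorem fanState_of_ge {y : ℝ} (hy : -(1 / 4) ≤ y) : fanState y = 11 / 10 := by
  rw [fanState, min_eq_right (by linarith), max_eq_left (by linarith),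
    show (49 : ℝ) = 7 ^ 2 by norm_num, Real.sqrt_sq (by norm_num)]
  norm_num

theorem lipschitzWith_fanState : LipschitzWith 1 fanState := by
  refine LipschitzWith.of_dist_le_mul fun y z => ?_
  have hc : LipschitzWith 1 fun r : ℝ => max 49 (min 169 r) :=
    (LipschitzWith.id.const_min _).const_max _
  have h := hc.dist_le_mul (34 - 60 * y) (34 - 60 * z)
  have hy : (7 : ℝ) ≤ √(max 49 (min 169 (34 - 60 * y))) := Real.le_sqrt_of_sq_le (by norm_num)
  have hz : (7 : ℝ) ≤ √(max 49 (min 169 (34 - 60 * z))) := Real.le_sqrt_of_sq_le (by norm_num)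
  have ey := Real.sq_sqrt
    (show 0 ≤ max 49 (min 169 (34 - 60 * y)) from le_max_of_le_left (by norm_num))
  have ez := Real.sq_sqrt
    (show 0 ≤ max 49 (min 169 (34 - 60 * z)) from le_max_of_le_left (by norm_num))
  simp only [Real.dist_eq, NNReal.coe_one, one_mul, fanState] at h ⊢
  rw [show 34 - 60 * y - (34 - 60 * z) = -60 * (y - z) by ring, abs_mul,
    show |(-60 : ℝ)| = 60 by norm_num] at h
  generalize √(max 49 (min 169 (34 - 60 * y))) = u at *
  generalize √(max 49 (min 169 (34 - 60 * z))) = w at *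
  rw [← ey, ← ez, show u ^ 2 - w ^ 2 = (u + w) * (u - w) by ring, abs_mul,
    abs_of_nonneg (by linarith)] at h
  rw [show (19 + 2 * u) / 30 - (19 + 2 * w) / 30 = 1 / 15 * (u - w) by ring, abs_mul,
    abs_of_nonneg (by norm_num : (0 : ℝ) ≤ 1 / 15)]
  have := mul_le_mul_of_nonneg_right (by linarith : (14 : ℝ) ≤ u + w) (abs_nonneg (u - w))
  have := abs_nonneg (u - w)
  have := abs_nonneg (y - z)
  linarith

/-- Among the states in `[11/10, 3/2]`, the state of the fan maximises `H(p) - p y`. -/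
theorem fanState_isMax (y : ℝ) {p : ℝ} (hp : p ∈ Icc (11 / 10 : ℝ) (3 / 2)) :
    nonlinearity p - p * y ≤ nonlinearity (fanState y) - fanState y * y := by
  have hq := fanState_mem y
  have h := nonlinearity_le_tangent hp.1 hq.1
  have e := Real.sq_sqrt
    (show 0 ≤ max 49 (min 169 (34 - 60 * y)) from le_max_of_le_left (by norm_num))
  have hslope : -(15 / 4) * fanState y ^ 2 + 19 / 4 * fanState y - 15 / 16
      = (34 - max 49 (min 169 (34 - 60 * y))) / 60 := by
    rw [← e, fanState]; ring
  have hvar : (-(15 / 4) * fanState y ^ 2 + 19 / 4 * fanState y - 15 / 16 - y)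
      * (p - fanState y) ≤ 0 := by
    rw [hslope]
    rcases le_total y (-(9 / 4)) with h1 | h1
    · rw [fanState_of_le h1, min_eq_left (by linarith), max_eq_right (by norm_num)]
      exact mul_nonpos_of_nonneg_of_nonpos (by linarith) (by linarith [hp.2])
    rcases le_total (-(1 / 4)) y with h2 | h2
    · rw [fanState_of_ge h2, min_eq_right (by linarith), max_eq_left (by linarith)]
      exact mul_nonpos_of_nonpos_of_nonneg (by linarith) (by linarith [hp.1])
    · rw [min_eq_right (by linarith), max_eq_right (by linarith)]
      apply le_of_eq; ring
  linarith

/-- The state of the fan centred at time `-1` and position `25`. -/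
noncomputable def fanAt (t x : ℝ) : ℝ := fanState ((x - 25) / (t + 1))

/-- The amount by which the solution with fan exceeds the affine solution of slope `-3/2`. -/
noncomputable def fan (t x : ℝ) : ℝ :=
  (nonlinearity (fanAt t x) + 1 / 8) * (t + 1) + (3 / 2 - fanAt t x) * (x - 25)

theorem fan_ge {p : ℝ} (hp : p ∈ Icc (11 / 10 : ℝ) (3 / 2)) {t : ℝ} (ht : -1 < t) (x : ℝ) :
    (nonlinearity p + 1 / 8) * (t + 1) + (3 / 2 - p) * (x - 25) ≤ fan t x := by
  have ht' : 0 < t + 1 := by linarith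
  have h := mul_le_mul_of_nonneg_right (fanState_isMax ((x - 25) / (t + 1)) hp) ht'.le
  have e : (x - 25) / (t + 1) * (t + 1) = x - 25 := div_mul_cancel₀ _ ht'.ne'
  rw [sub_mul, sub_mul, mul_assoc, mul_assoc, e] at h
  rw [fan, fanAt]
  linarith

/-- The fan is a supremum of affine functions of `(t, x)`, so it lies above each of its
tangents. -/
theorem fan_subgradient {t : ℝ} (x : ℝ) {s : ℝ} (hs : -1 < s) (y : ℝ) :
    fan t x + ((nonlinearity (fanAt t x) + 1 / 8) * (s - t) + (3 / 2 - fanAt t x) * (y - x))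
      ≤ fan s y := by
  refine le_trans (le_of_eq ?_) (fan_ge (fanState_mem ((x - 25) / (t + 1))) hs y)
  rw [fan, fanAt]; ring

theorem hasFDerivAt_fan {z : ℝ × ℝ} (hz : -1 < z.1) :
    HasFDerivAt (Function.uncurry fan)
      (gradientForm (nonlinearity (fanAt z.1 z.2) + 1 / 8) (3 / 2 - fanAt z.1 z.2)) z := by
  have h := hasFDerivAt_of_supergradient (g := fun w => -Function.uncurry fan w) (z := z)
    (L := fun z => -gradientForm (nonlinearity (fanAt z.1 z.2) + 1 / 8) (3 / 2 - fanAt z.1 z.2))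
    ((isOpen_Ioi.preimage continuous_fst).mem_nhds hz) (fun z _ w hw => ?_) ?_
  · simpa using h.fun_neg
  · have := fan_subgradient (t := z.1) z.2 hw w.2
    simp only [Function.uncurry, neg_apply, gradientForm_apply, Prod.fst_sub, Prod.snd_sub]
    linarith
  · have h1 : ContinuousAt (fun z : ℝ × ℝ => fanAt z.1 z.2) z := by
      refine lipschitzWith_fanState.continuous.continuousAt.comp ?_
      exact (by fun_prop : ContinuousAt (fun z : ℝ × ℝ => z.2 - 25) z).div (by fun_prop)
        (by linarith)
    have h2 := continuous_nonlinearity.continuousAt.comp h1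
    simp only [Function.comp_def] at h2
    unfold gradientForm
    fun_prop

theorem hasDerivAt_fan {t : ℝ} (ht : -1 < t) (x : ℝ) :
    HasDerivAt (fan t) (3 / 2 - fanAt t x) x := by
  refine hasDerivAt_of_subgradient (A := fun x => 3 / 2 - fanAt t x) ?_ (fun x y => ?_) x
  · have := lipschitzWith_fanState.continuous
    unfold fanAt
    fun_prop
  · simpa using fan_subgradient (t := t) x ht y

theorem fan_of_le {t x : ℝ} (ht : -1 < t) (hx : x - 25 ≤ -(9 / 4) * (t + 1)) : fan t x = 0 := by
  have : fanAt t x = 3 / 2 := fanState_of_le (by rwa [div_le_iff₀ (by linarith)])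
  rw [fan, this, nonlinearity_three_halves]; ring

theorem fan_of_ge {t x : ℝ} (ht : -1 < t) (hx : -(1 / 4) * (t + 1) ≤ x - 25) :
    fan t x = 23 / 50 * (t + 1) + 2 / 5 * (x - 25) := by
  have : fanAt t x = 11 / 10 := fanState_of_ge (by rwa [le_div_iff₀ (by linarith)])
  rw [fan, this, show nonlinearity (11 / 10) = 67 / 200 by norm_num [nonlinearity]]; ring

/-- The state of the fan decreases in space with slope at least `-1`. -/
theorem monotone_fan_remainder {t : ℝ} (ht : 0 ≤ t) : Monotone fun x => x + fanAt t x := by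
  intro x y hxy
  have h := lipschitzWith_fanState.dist_le_mul ((x - 25) / (t + 1)) ((y - 25) / (t + 1))
  rw [NNReal.coe_one, one_mul, Real.dist_eq, Real.dist_eq, ← sub_div,
    show x - 25 - (y - 25) = -(y - x) by ring, abs_div, abs_neg,
    abs_of_nonneg (sub_nonneg.2 hxy), abs_of_nonneg (by linarith : 0 ≤ t + 1)] at h
  have h1 : (y - x) / (t + 1) ≤ y - x := div_le_self (sub_nonneg.2 hxy) (by linarith)
  have h2 := (abs_le.1 (h.trans h1)).2
  simp only [fanAt]
  linarith

theorem convexOn_sq_sub_fan {t : ℝ} (ht : 0 ≤ t) :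
    ConvexOn ℝ univ fun x => 1 / 2 * x ^ 2 - fan t x := by
  have hd : ∀ x, HasDerivAt (fun x => 1 / 2 * x ^ 2 - fan t x) (x - (3 / 2 - fanAt t x)) x := by
    intro x
    refine (((hasDerivAt_pow 2 x).const_mul (1 / 2)).sub
      (hasDerivAt_fan (by linarith : -1 < t) x)).congr_deriv ?_
    simp
  refine Monotone.convexOn_univ_of_deriv (fun x => (hd x).differentiableAt) ?_
  rw [funext fun x => (hd x).deriv]
  intro x y hxy
  have := monotone_fan_remainder ht hxy
  simp only at this ⊢
  linarith

/-! ### The counterexample -/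

/-- The semi-concave solution: two shocks collide at the origin and form the wedge of slopes
`±3/2`, which the two fans reach later and open up to slopes `±11/10`. Negative times are sent
to time `0`. -/
noncomputable def solution (t x : ℝ) : ℝ := wedge (max t 0) x + fan (max t 0) |x|

theorem solution_of_nonneg {t : ℝ} (ht : 0 ≤ t) (x : ℝ) :
    solution t x = wedge t x + fan t |x| := by
  rw [solution, max_eq_left ht]

theorem solution_of_nonpos (t : ℝ) (ht : t ≤ 0) : solution t = solution 0 := by
  funext x
  rw [solution, solution, max_eq_right ht, max_self]

theorem fan_abs_eq_add {t : ℝ} (ht : 0 ≤ t) (ht' : t ≤ 9) (x : ℝ) :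
    fan t |x| = fan t x + fan t (-x) := by
  have h : ∀ y ≤ 0, fan t y = 0 := fun y hy => fan_of_le (by linarith) (by linarith)
  rcases le_total 0 x with hx | hx
  · rw [abs_of_nonneg hx, h (-x) (by linarith), add_zero]
  · rw [abs_of_nonpos hx, h x hx, zero_add]

theorem lipschitzOnWith_fan :
    LipschitzOnWith 3 (Function.uncurry fan) (Ici 0 ×ˢ (univ : Set ℝ)) := by
  have h : LipschitzOnWith 3 (fun z => -Function.uncurry fan z) (Ici 0 ×ˢ (univ : Set ℝ)) := by
    refine lipschitzOnWith_of_supergradient fun z _ => ?_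
    have hq : fanAt z.1 z.2 ∈ Icc (11 / 10 : ℝ) (3 / 2) := fanState_mem _
    have hb := nonlinearity_bounds ⟨by linarith [hq.1], hq.2⟩
    refine ⟨-(nonlinearity (fanAt z.1 z.2) + 1 / 8), -(3 / 2 - fanAt z.1 z.2),
      abs_le.2 ⟨by linarith, by linarith⟩, abs_le.2 ⟨by linarith [hq.1], by linarith [hq.2]⟩,
      fun w hw => ?_⟩
    have := fan_subgradient (t := z.1) z.2
      (lt_of_lt_of_le (by norm_num) hw.1 : (-1 : ℝ) < w.1) w.2
    simp only [Function.uncurry]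
    linarith
  refine LipschitzOnWith.of_dist_le_mul fun z hz w hw => ?_
  simpa only [dist_neg_neg] using h.dist_le_mul z hz w hw

theorem lipschitzWith_solution : LipschitzWith 6 (Function.uncurry solution) := by
  have hp : LipschitzWith 1 fun z : ℝ × ℝ => (max z.1 0, z.2) := by
    simpa using (LipschitzWith.prod_fst.max_const 0).prodMk LipschitzWith.prod_snd
  have ha : LipschitzWith 1 fun z : ℝ × ℝ => (max z.1 0, |z.2|) := by
    have h : LipschitzWith 1 fun z : ℝ × ℝ => |z.2| := by
      have := (lipschitzWith_one_norm (E := ℝ)).comp (LipschitzWith.prod_snd (α := ℝ))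
      rw [mul_one] at this
      exact this
    simpa using (LipschitzWith.prod_fst.max_const 0).prodMk h
  have h1 := lipschitzWith_wedge.comp hp
  have h2 := lipschitzOnWith_fan.comp ha.lipschitzOnWith (s := univ)
    (fun z _ => ⟨mem_Ici.2 (le_max_right _ _), mem_univ _⟩)
  rw [lipschitzOnWith_univ] at h2
  have := h1.add h2
  norm_num at this
  exact this

theorem convexOn_comp_neg {g : ℝ → ℝ} (hg : ConvexOn ℝ univ g) :
    ConvexOn ℝ univ fun x => g (-x) := by
  simpa [Function.comp_def] using hg.comp_linearMap (-LinearMap.id)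

theorem fan_sub_le {t : ℝ} (ht : 0 ≤ t) {x : ℝ} (hx : 0 ≤ x) :
    fan t x - fan t (-x) ≤ 3 * x := by
  have h := fan_subgradient (t := t) x (by linarith : -1 < t) (-x)
  have hq : fanAt t x ∈ Icc (11 / 10 : ℝ) (3 / 2) := fanState_mem _
  simp only [sub_self, mul_zero, zero_add] at h
  have := mul_le_mul_of_nonneg_right (by linarith [hq.1] : 3 / 2 - fanAt t x ≤ 3 / 2) hx
  linarith

/-- Before time `9` the fans live on disjoint half-lines and the wedge is concave; after time `9`
the solution is a minimum of two semi-concave functions. -/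
theorem convexOn_sq_sub_solution (t : ℝ) :
    ConvexOn ℝ univ fun x => 1 * x ^ 2 - solution t x := by
  wlog ht : 0 ≤ t generalizing t
  · rw [solution_of_nonpos t (by linarith)]
    exact this 0 le_rfl
  have hfan := convexOn_sq_sub_fan ht
  have hfan' := convexOn_comp_neg hfan
  rcases le_total t 9 with h9 | h9
  · refine ((hfan.add hfan').add (convexOn_neg_wedge t)).congr fun x _ => ?_
    simp only [Pi.add_apply]
    rw [solution_of_nonneg ht, fan_abs_eq_add ht h9]
    ring
  · have hsq : ConvexOn ℝ univ fun x : ℝ => 1 / 2 * x ^ 2 + 3 / 2 * x + (t / 8 - 9 / 8) := by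
      refine convexOn_of_exists_subgradient fun x => ⟨x + 3 / 2, fun y => ?_⟩
      nlinarith [sq_nonneg (x - y)]
    have hm := hfan.add hsq
    refine (hm.sup (convexOn_comp_neg hm)).congr fun x _ => ?_
    simp only [Pi.sup_apply, Pi.add_apply]
    rw [solution_of_nonneg ht, wedge_eq_abs ht (Or.inr h9)]
    rcases le_total 0 x with hx | hx
    · have := fan_sub_le ht hx
      rw [abs_of_nonneg hx, sup_of_le_left (by linarith)]
      ring
    · have := fan_sub_le ht (neg_nonneg.2 hx)
      rw [neg_neg] at this
      rw [abs_of_nonpos hx, sup_of_le_right (by linarith)]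
      ring

theorem isC11_solution_zero : IsC11 (solution 0) := by
  have hd : ∀ x, HasDerivAt (solution 0)
      (-clampSlope x + (3 / 2 - fanAt 0 x) + -(3 / 2 - fanAt 0 (-x))) x := by
    intro x
    have h1 := hasDerivAt_fan (by norm_num : (-1 : ℝ) < 0) x
    have h2 := (hasDerivAt_fan (by norm_num : (-1 : ℝ) < 0) (-x)).scomp x (hasDerivAt_neg x)
    refine HasDerivAt.congr_of_eventuallyEq ((((hasDerivAt_wedge_zero x).add h1).add h2).congr_deriv
      (by simp)) (Filter.Eventually.of_forall fun y => ?_)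
    rw [solution_of_nonneg le_rfl, fan_abs_eq_add le_rfl (by norm_num)]
    simp [Function.comp_def, add_assoc]
  refine ⟨fun x => (hd x).differentiableAt, 3, ?_⟩
  rw [funext fun x => (hd x).deriv]
  have h0 : LipschitzWith 1 fun x => fanAt 0 x := by
    have := lipschitzWith_fanState.comp
      ((LipschitzWith.id (α := ℝ)).sub (LipschitzWith.const (25 : ℝ)))
    simpa [fanAt, Function.comp_def] using this
  have h1 : LipschitzWith 1 fun x => 3 / 2 - fanAt 0 x := by
    simpa using (LipschitzWith.const (3 / 2 : ℝ)).sub h0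
  have h2 : LipschitzWith 1 fun x => -(3 / 2 - fanAt 0 (-x)) := by
    have := (h1.comp (LipschitzWith.id (α := ℝ)).neg).neg
    rw [mul_one] at this
    exact this
  have := (lipschitzWith_clampSlope.neg.add h1).add h2
  rw [show (3 : NNReal) = 1 + 1 + 1 by norm_num]
  exact this

/-- Where the wedge is formed, the solution is on each side of the origin a classical one. -/
theorem hasFDerivAt_outer {z : ℝ × ℝ} (hz : 0 < z.1) :
    HasFDerivAt (fun w : ℝ × ℝ => -(3 / 2) * w.2 - w.1 / 8 + 9 / 8 + fan w.1 w.2)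
      (gradientForm (nonlinearity (fanAt z.1 z.2)) (-fanAt z.1 z.2)) z := by
  have h1 : HasFDerivAt (fun w : ℝ × ℝ => gradientForm (-(1 / 8)) (-(3 / 2)) w + 9 / 8)
      (gradientForm (-(1 / 8)) (-(3 / 2))) z :=
    (gradientForm (-(1 / 8)) (-(3 / 2))).hasFDerivAt.add_const _
  have h2 := h1.fun_add (hasFDerivAt_fan (by linarith : -1 < z.1))
  refine (h2.congr_fderiv ?_).congr_of_eventuallyEq (Filter.Eventually.of_forall fun w => ?_)
  · refine ContinuousLinearMap.ext fun w => ?_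
    simp only [add_apply, gradientForm_apply]
    ring
  · simp only [gradientForm_apply, Function.uncurry]
    ring

/-- The equation at a point `z` where the gradient is `(H(q), q)`. -/
theorem equation_of_hasFDerivAt {g : ℝ × ℝ → ℝ} {z : ℝ × ℝ} {p q : ℝ}
    (h : HasFDerivAt g (gradientForm p q) z) (hp : p = nonlinearity q) :
    DifferentiableAt ℝ g z ∧ fderiv ℝ g z (1, 0) - nonlinearity (fderiv ℝ g z (0, 1)) = 0 := by
  refine ⟨h.differentiableAt, ?_⟩
  rw [h.fderiv]
  simp [hp]

theorem equation_of_outer {z : ℝ × ℝ} (ht : 0 < z.1) (hx : z.2 ≠ 0)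
    (h : 3 / 2 < |z.2| ∨ 9 < z.1) :
    DifferentiableAt ℝ (Function.uncurry solution) z ∧
      fderiv ℝ (Function.uncurry solution) z (1, 0)
        - nonlinearity (fderiv ℝ (Function.uncurry solution) z (0, 1)) = 0 := by
  have hev : ∀ᶠ w : ℝ × ℝ in nhds z,
      0 < w.1 ∧ 0 < z.2 * w.2 ∧ (3 / 2 < |w.2| ∨ 9 < w.1) := by
    refine (continuousAt_const.eventually_lt continuousAt_fst ht).and
      ((continuousAt_const.eventually_lt
        (by fun_prop : ContinuousAt (fun w : ℝ × ℝ => z.2 * w.2) z) (mul_self_pos.2 hx)).and ?_)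
    rcases h with h | h
    · filter_upwards [continuousAt_const.eventually_lt
        (by fun_prop : ContinuousAt (fun w : ℝ × ℝ => |w.2|) z) h] with w hw using Or.inl hw
    · filter_upwards [continuousAt_const.eventually_lt continuousAt_fst h] with w hw using Or.inr hw
  rcases lt_or_gt_of_ne hx with hx | hx
  · have h1 := (hasFDerivAt_outer (z := (z.1, -z.2)) ht).comp z
      (f := fun w : ℝ × ℝ => (w.1, -w.2)) (hasFDerivAt_fst.prodMk hasFDerivAt_snd.neg)
    refine equation_of_hasFDerivAt (p := nonlinearity (fanAt z.1 (-z.2))) (q := fanAt z.1 (-z.2))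
      ((h1.congr_of_eventuallyEq ?_).congr_fderiv ?_) rfl
    · filter_upwards [hev] with w hw
      have hw2 : w.2 < 0 := by
        by_contra hcon
        nlinarith [hw.2.1]
      simp only [Function.uncurry, Function.comp_apply]
      rw [solution_of_nonneg hw.1.le, wedge_eq_abs hw.1.le (hw.2.2.imp le_of_lt le_of_lt),
        abs_of_neg hw2]
    · refine ContinuousLinearMap.ext fun w => ?_
      simp
  · refine equation_of_hasFDerivAt ((hasFDerivAt_outer ht).congr_of_eventuallyEq ?_)
      (even_nonlinearity _).symm
    filter_upwards [hev] with w hw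
    have hw2 : 0 < w.2 := pos_of_mul_pos_right hw.2.1 hx.le
    simp only [Function.uncurry]
    rw [solution_of_nonneg hw.1.le, wedge_eq_abs hw.1.le (hw.2.2.imp le_of_lt le_of_lt),
      abs_of_pos hw2]

theorem equation_of_inner {z : ℝ × ℝ} (ht : 0 < z.1) (h : |z.2| - 25 < -(9 / 4) * (z.1 + 1))
    (hd : DifferentiableAt ℝ (Function.uncurry wedge) z) :
    DifferentiableAt ℝ (Function.uncurry solution) z ∧
      fderiv ℝ (Function.uncurry solution) z (1, 0)
        - nonlinearity (fderiv ℝ (Function.uncurry solution) z (0, 1)) = 0 := by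
  obtain ⟨a, -, ha⟩ := wedge_supergradient z.1 z.2
  have hL := fderiv_eq_of_supergradient (L := gradientForm (nonlinearity a) a) hd
    fun w => by simpa [Function.uncurry] using ha w.1 w.2
  have h1 := hd.hasFDerivAt
  rw [hL] at h1
  refine equation_of_hasFDerivAt (h1.congr_of_eventuallyEq ?_) rfl
  filter_upwards [continuousAt_const.eventually_lt continuousAt_fst ht,
    ContinuousAt.eventually_lt (by fun_prop : ContinuousAt (fun w : ℝ × ℝ => |w.2| - 25) z)
      (by fun_prop : ContinuousAt (fun w : ℝ × ℝ => -(9 / 4) * (w.1 + 1)) z) h] with w hw hw'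
  simp only [Function.uncurry]
  rw [solution_of_nonneg hw.le, fan_of_le (by linarith) hw'.le, add_zero]

theorem isSemiconcaveSolution_solution :
    IsSemiconcaveSolution nonlinearity (Ici 0) solution where
  lipschitz := ⟨6, lipschitzWith_solution.lipschitzOnWith⟩
  initial := isC11_solution_zero
  equation := by
    rw [ae_restrict_iff' (measurableSet_Ici.prod .univ)]
    filter_upwards [lipschitzWith_wedge.ae_differentiableAt, ae_fst_ne 0, ae_snd_ne 0]
      with z hd ht hx hz
    have ht' : 0 < z.1 := lt_of_le_of_ne hz.1 ht.symm
    by_cases h : 3 / 2 < |z.2| ∨ 9 < z.1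
    · exact equation_of_outer ht' hx h
    · push Not at h
      exact equation_of_inner ht' (by linarith [h.1, h.2]) hd
  semiconcave := ⟨1, one_pos, fun t _ => convexOn_sq_sub_solution t⟩

theorem IsSemiconcaveSolution.mono {H : ℝ → ℝ} {I J : Set ℝ} {f : ℝ → ℝ → ℝ} (hJI : J ⊆ I)
    (h : IsSemiconcaveSolution H I f) : IsSemiconcaveSolution H J f where
  lipschitz := h.lipschitz.imp fun _ hK => hK.mono (prod_mono_left hJI)
  initial := h.initial
  equation := ae_mono (Measure.restrict_mono (prod_mono_left hJI) le_rfl) h.equation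
  semiconcave := h.semiconcave.imp fun _ hc => ⟨hc.1, fun t ht => hc.2 t (hJI ht)⟩

theorem solution_of_large {t : ℝ} (ht : 99 ≤ t) (x : ℝ) :
    solution t x = 67 / 200 * t - 11 / 10 * |x| - 1683 / 200 := by
  have hx := abs_nonneg x
  rw [solution_of_nonneg (by linarith), wedge_eq_abs (by linarith) (Or.inr (by linarith)),
    fan_of_ge (by linarith) (by linarith)]
  ring

/-- At the kink of the late solution, the test function `67/200 t` violates the subsolution
property, since `H(0) = 0 < 67/200`. -/
theorem not_isViscositySolution_solution {I : Set ℝ} (hI : (100 : ℝ) ∈ interior I) :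
    ¬ IsViscositySolution nonlinearity I (solution 0) solution := by
  intro h
  have h1 := h.subsolution (gradientForm (67 / 200) 0) (ContinuousLinearMap.contDiff _) (100, 0) hI
    (by
      filter_upwards [continuousAt_const.eventually_lt continuousAt_fst
        (by norm_num : (99 : ℝ) < ((100, 0) : ℝ × ℝ).1)] with w hw
      simp only [Function.uncurry, gradientForm_apply]
      rw [solution_of_large hw.le, solution_of_large (by norm_num)]
      have := abs_nonneg w.2
      simp only [abs_zero]
      linarith)
  rw [ContinuousLinearMap.fderiv] at h1
  simp [nonlinearity_zero] at h1
  linarith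

theorem not_selectionPrinciple : ¬ SelectionPrinciple nonlinearity := by
  intro h
  refine not_isViscositySolution_solution (I := Icc 0 101) ?_ (h 101 (by norm_num) solution
    (isSemiconcaveSolution_solution.mono Icc_subset_Ici_self))
  rw [interior_Icc]
  constructor <;> norm_num

/-! ### Failure of the entropy inequality -/

theorem velocity_solution_of_large {t : ℝ} (ht : 99 ≤ t) {x : ℝ} (hx : x ≠ 0) :
    velocity solution t x = if 0 < x then 11 / 10 else -(11 / 10) := by
  have hs : solution t = fun x => 67 / 200 * t - 11 / 10 * |x| - 1683 / 200 :=
    funext (solution_of_large ht)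
  rcases lt_or_gt_of_ne hx with h | h
  · have hd : HasDerivAt (solution t) (-(11 / 10 * -1)) x := by
      rw [hs]
      exact (((hasDerivAt_abs_neg h).const_mul (11 / 10)).const_sub _).sub_const _
    rw [velocity_eq_of_hasDerivWithinAt hd.hasDerivWithinAt, if_neg h.not_gt]
    norm_num
  · have hd : HasDerivAt (solution t) (-(11 / 10 * 1)) x := by
      rw [hs]
      exact (((hasDerivAt_abs_pos h).const_mul (11 / 10)).const_sub _).sub_const _
    rw [velocity_eq_of_hasDerivWithinAt hd.hasDerivWithinAt, if_pos h]
    norm_num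

/-- The entropy flux of the quadratic entropy, integrated by parts:
`∫₀ᵖ H'(s) 2s ds = 2 (p H(p) - ∫₀ᵖ H)`. -/
noncomputable def quadraticFlux (p : ℝ) : ℝ :=
  2 * (p * nonlinearity p - ∫ s in (0 : ℝ)..p, nonlinearity s)

theorem hasDerivAt_quadraticFlux (p : ℝ) :
    HasDerivAt quadraticFlux (deriv nonlinearity p * (2 * p)) p := by
  have h1 : HasDerivAt nonlinearity (deriv nonlinearity p) p :=
    ((contDiff_nonlinearity.differentiable (by norm_num)) p).hasDerivAt
  have h2 := intervalIntegral.integral_hasDerivAt_right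
    (continuous_nonlinearity.intervalIntegrable 0 p)
    (continuous_nonlinearity.stronglyMeasurableAtFilter _ _) continuous_nonlinearity.continuousAt
  refine ((((hasDerivAt_id p).mul h1).sub h2).const_mul 2).congr_deriv ?_
  simp only [id_eq]
  ring

theorem quadraticFlux_neg (p : ℝ) : quadraticFlux (-p) = -quadraticFlux p := by
  have h := intervalIntegral.integral_comp_neg (a := 0) (b := p) nonlinearity
  simp only [even_nonlinearity _] at h
  rw [neg_zero, intervalIntegral.integral_symm 0 (-p)] at h
  rw [quadraticFlux, quadraticFlux, even_nonlinearity, h]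
  ring

/-- On `[0, 11/10]` the average of `H` is less than its value at the right end: this is how the
violation of the chord condition enters. -/
theorem quadraticFlux_pos : 0 < quadraticFlux (11 / 10) := by
  have h : ∫ s in (0 : ℝ)..11 / 10, nonlinearity s ≤ ∫ s in (0 : ℝ)..11 / 10, s ^ 2 / 2 :=
    intervalIntegral.integral_mono_on (by norm_num) (continuous_nonlinearity.intervalIntegrable _ _)
      ((by fun_prop : Continuous fun s : ℝ => s ^ 2 / 2).intervalIntegrable _ _)
      fun s _ => nonlinearity_le s
  rw [intervalIntegral.integral_div, integral_pow] at h
  rw [quadraticFlux, show nonlinearity (11 / 10) = 67 / 200 by norm_num [nonlinearity]]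
  norm_num at h
  linarith

theorem integral_sign_mul_deriv {χ : ℝ → ℝ} (hχ : ContDiff ℝ 1 χ) (hs : HasCompactSupport χ) :
    ∫ x, (if 0 < x then 1 else -1) * deriv χ x = -2 * χ 0 := by
  have hint : Integrable (deriv χ) :=
    (hχ.continuous_deriv le_rfl).integrable_of_hasCompactSupport hs.deriv
  have h1 : EqOn (fun x => (if 0 < x then 1 else -1) * deriv χ x) (deriv χ) (Ioi 0) := by
    intro x hx
    simp only [if_pos (mem_Ioi.1 hx), one_mul]
  have h2 : EqOn (fun x => (if 0 < x then 1 else -1) * deriv χ x) (fun x => -deriv χ x)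
      (Iic 0) := by
    intro x hx
    simp only [if_neg (not_lt.2 (mem_Iic.1 hx)), neg_mul, one_mul]
  rw [← intervalIntegral.integral_Iic_add_Ioi (b := 0)
    (hint.neg.integrableOn.congr_fun h2.symm measurableSet_Iic)
    (hint.integrableOn.congr_fun h1.symm measurableSet_Ioi),
    setIntegral_congr_fun measurableSet_Ioi h1, setIntegral_congr_fun measurableSet_Iic h2,
    integral_neg, hs.integral_Iic_deriv_eq hχ, hs.integral_Ioi_deriv_eq hχ]
  ring

/-- A state jumping from `-11/10` to `11/10` across `x = 0` at late times dissipates the quadratic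
entropy with the wrong sign. -/
theorem not_isEntropySolution_velocity :
    ¬ IsEntropySolution nonlinearity (velocity solution 0) (velocity solution) := by
  intro h
  let χ : ContDiffBump (101 : ℝ) := ⟨1 / 2, 1, by norm_num, by norm_num⟩
  let η : ContDiffBump (0 : ℝ) := ⟨1 / 2, 1, by norm_num, by norm_num⟩
  have hχ0 : ∀ t < 100, χ t = 0 := by
    intro t ht
    refine χ.zero_of_le_dist ?_
    rw [Real.dist_eq, abs_sub_comm]
    exact le_trans (by simp only [χ]; linarith) (le_abs_self _)
  have hη0 : η 0 = 1 := η.one_of_mem_closedBall (by simp [η.rIn_pos.le])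
  have hχ : ContDiff ℝ ∞ χ := χ.contDiff
  have hη : ContDiff ℝ ∞ η := η.contDiff
  let φ : ℝ × ℝ → ℝ := fun z => χ z.1 * η z.2
  have hφ : ContDiff ℝ ∞ φ := (hχ.comp contDiff_fst).mul (hη.comp contDiff_snd)
  have hφs : HasCompactSupport φ := by
    refine HasCompactSupport.intro
      (χ.hasCompactSupport.isCompact.prod η.hasCompactSupport.isCompact)
      fun z hz => ?_
    by_contra hne
    exact hz ⟨subset_tsupport _ (left_ne_zero_of_mul hne),
      subset_tsupport _ (right_ne_zero_of_mul hne)⟩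
  have hφ0 : ∀ z, 0 ≤ φ z := fun z => mul_nonneg χ.nonneg η.nonneg
  have hE : ConvexOn ℝ univ fun p : ℝ => p ^ 2 - (11 / 10) ^ 2 := by
    refine convexOn_of_exists_subgradient fun x => ⟨2 * x, fun y => ?_⟩
    nlinarith [sq_nonneg (x - y)]
  -- the entropy is normalised to vanish at the late states `±11/10`
  have hpair := h.entropy (fun p => p ^ 2 - (11 / 10) ^ 2) (fun p => 2 * p) quadraticFlux hE
    (fun p => by simpa using (hasDerivAt_pow 2 p).sub_const ((11 / 10 : ℝ) ^ 2))
    hasDerivAt_quadraticFlux φ hφ hφs hφ0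
  have hfd : ∀ z : ℝ × ℝ, HasFDerivAt φ
      (gradientForm (deriv χ z.1 * η z.2) (χ z.1 * deriv η z.2)) z := by
    intro z
    have h1 := ((hχ.differentiable (by simp)) z.1).hasDerivAt.comp_hasFDerivAt z
      (hasFDerivAt_fst (𝕜 := ℝ) (p := z))
    have h2 := ((hη.differentiable (by simp)) z.2).hasDerivAt.comp_hasFDerivAt z
      (hasFDerivAt_snd (𝕜 := ℝ) (p := z))
    refine (h1.mul h2).congr_fderiv (ContinuousLinearMap.ext fun w => ?_)
    simp
    ring
  have h1 : ∫ z in Ioi (0 : ℝ) ×ˢ (univ : Set ℝ),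
      (((velocity solution z.1 z.2) ^ 2 - (11 / 10) ^ 2) * fderiv ℝ φ z (1, 0)
        + quadraticFlux (velocity solution z.1 z.2) * fderiv ℝ φ z (0, 1))
      = ∫ z in Ioi (0 : ℝ) ×ˢ (univ : Set ℝ),
        quadraticFlux (11 / 10) * χ z.1 * ((if 0 < z.2 then 1 else -1) * deriv η z.2) := by
    refine setIntegral_congr_ae (measurableSet_Ioi.prod .univ) ?_
    filter_upwards [ae_snd_ne 0] with z hz _
    rw [(hfd z).fderiv]
    simp only [gradientForm_apply, mul_one, mul_zero, add_zero, zero_add]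
    rcases lt_or_ge z.1 100 with ht | ht
    · have hd : deriv χ z.1 = 0 := by
        have : (χ : ℝ → ℝ) =ᶠ[nhds z.1] fun _ => 0 := by
          filter_upwards [Iio_mem_nhds ht] with t ht using hχ0 t ht
        rw [this.deriv_eq, deriv_const]
      rw [hd, hχ0 _ ht]
      ring
    · rw [velocity_solution_of_large (by linarith) hz]
      split_ifs
      · ring
      · rw [quadraticFlux_neg]
        ring
  have hpos : 0 < ∫ t in Ioi (0 : ℝ), χ t := by
    rw [setIntegral_eq_integral_of_forall_compl_eq_zero fun t ht => hχ0 t (by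
      have := notMem_Ioi.1 ht
      linarith)]
    exact χ.integral_pos
  rw [weakPairing, h1, Measure.volume_eq_prod,
    setIntegral_prod_mul (fun t => quadraticFlux (11 / 10) * χ t)
    (fun x => (if 0 < x then 1 else -1) * deriv η x), setIntegral_univ,
    integral_sign_mul_deriv (hη.of_le (by simp)) η.hasCompactSupport, hη0,
    integral_const_mul] at hpair
  have h0 : ∀ x, φ (0, x) = 0 := fun x => by simp [φ, hχ0 0 (by norm_num)]
  simp only [h0, mul_zero, integral_zero, add_zero] at hpair
  have := mul_pos quadraticFlux_pos hpos
  linarith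

end HJCounterexample

theorem mainTheorem2 :
    -- the explicit nonlinearity is `C²`, even and not convex
    ContDiff ℝ 2 HJCounterexample.nonlinearity ∧
    Function.Even HJCounterexample.nonlinearity ∧
    ¬ ConvexOn ℝ Set.univ HJCounterexample.nonlinearity ∧
    (∃ (v₀ : ℝ → ℝ) (v : ℝ → ℝ → ℝ) (f : ℝ → ℝ → ℝ),
      -- `v` is a bounded, one-sided Lipschitz, non-entropy solution with Lipschitz datum `v₀`
      (∃ K, LipschitzWith K v₀) ∧
      v 0 = v₀ ∧
      HJCounterexample.IsWeakSolution HJCounterexample.nonlinearity v₀ v ∧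
      (∃ c : ℝ, 0 ≤ c ∧ ∀ t, 0 ≤ t → HJCounterexample.OneSidedLipschitzWith c (v t)) ∧
      ¬ HJCounterexample.IsEntropySolution HJCounterexample.nonlinearity v₀ v ∧
      -- `f(t, ·)` is a primitive of `-v(t, ·)`
      (∀ t, 0 ≤ t → ∀ a b : ℝ, f t b - f t a = -∫ y in a..b, v t y) ∧
      -- `f` is a semi-concave a.e. solution with `C^{1,1}` datum, and not a viscosity solution
      HJCounterexample.IsSemiconcaveSolution HJCounterexample.nonlinearity (Set.Ici 0) f ∧
      ¬ HJCounterexample.IsViscositySolution HJCounterexample.nonlinearity (Set.Ici 0) (f 0) f) ∧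
    -- so the selection principle fails for this nonlinearity
    ¬ HJCounterexample.SelectionPrinciple HJCounterexample.nonlinearity := by
  open HJCounterexample in
  refine ⟨contDiff_nonlinearity, even_nonlinearity, not_convexOn_nonlinearity,
    ⟨velocity solution 0, velocity solution, solution, ?_, rfl,
      isWeakSolution_velocity even_nonlinearity lipschitzWith_solution convexOn_sq_sub_solution
        solution_of_nonpos isSemiconcaveSolution_solution,
      ⟨2 * 1, by norm_num, fun t _ => oneSidedLipschitzWith_velocity (convexOn_sq_sub_solution t)⟩,
      not_isEntropySolution_velocity,
      fun t _ => integral_velocity lipschitzWith_solution convexOn_sq_sub_solution t,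
      isSemiconcaveSolution_solution,
      not_isViscositySolution_solution (by rw [interior_Ici]; exact mem_Ioi.2 (by norm_num))⟩,
    not_selectionPrinciple⟩
  obtain ⟨hd, K, hK⟩ := isC11_solution_zero
  refine ⟨K, ?_⟩
  rw [show velocity solution 0 = fun x => -deriv (solution 0) x from
    funext fun x => velocity_eq_deriv (hd x)]
  exact hK.neg
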